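/- Let $G_0=\mathrm{Sym}(7)$ and, for $n\ge 0$, let $G_{n+1}=\mathrm{Sym}(G_n)$ be the group of all permutations of the set $G_n$, into which $G_n$ is embedded by its right regular representation. Let $G_\omega=\varinjlim_n G_n$ be the direct limit (Hall's universal locally finite group), and identify each $G_n$ with its image in $G_\omega$. Let $\mathrm{Aut}_\omega(G_\omega)$ be the group of all automorphisms $\varphi$ of $G_\omega$ that preserve every level, that is, $\varphi[G_n]=G_n$ for all $n\in\mathbb{N}$. Then \[ \mathrm{Aut}_\omega(G_\omega)\;\cong\;\mathrm{Sym}(7)\times\prod_{i=0}^{\infty}\mathrm{Sym}(n_i), \] an isomorphism of groups, where $n_0=7$ and $n_{i+1}=n_i!$ for all $i\in\mathbb{N}$, and the product is the full (unrestricted) direct product. -/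

import Mathlib

/-- The right regular representation of a group `G` in the group `Sym(G)` of all permutations of
the set `G`. Permutations are multiplied as `(σ * τ) x = σ (τ x)`, so the homomorphism sends `g` to
the translation `x ↦ x * g⁻¹`. -/
def rightRegular (G : Type*) [Group G] : G →* Equiv.Perm G where
  toFun g := Equiv.mulRight g⁻¹
  map_one' := by ext x; simp
  map_mul' g h := by ext x; simp [mul_assoc]

/-- The levels of the limit of regular representations of length `ω` with base `B`:
`G_0 = B` and `G_{n+1} = Sym(G_n)`. -/
def RegLevel (B : Type*) : ℕ → Type _
  | 0 => B
  | n + 1 => Equiv.Perm (RegLevel B n)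

/-- The group structure on the levels: the given one on `G_0`, composition on `Sym(G_n)`. -/
instance RegLevel.instGroup (B : Type*) [Group B] : (n : ℕ) → Group (RegLevel B n)
  | 0 => inferInstanceAs (Group B)
  | n + 1 => inferInstanceAs (Group (Equiv.Perm (RegLevel B n)))

/-- The embedding of `G_n` into `G_{n+1} = Sym(G_n)` via the right regular representation. -/
def RegLevel.step (B : Type*) [Group B] (n : ℕ) : RegLevel B n →* RegLevel B (n + 1) :=
  rightRegular (RegLevel B n)

/-- The embedding `G_m → G_n` for `m ≤ n`, the composite of the embeddings of consecutive levels. -/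
def RegLevel.trans (B : Type*) [Group B] (m n : ℕ) (h : m ≤ n) : RegLevel B m →* RegLevel B n :=
  Nat.leRec (motive := fun k _ => RegLevel B m →* RegLevel B k) (MonoidHom.id _)
    (fun k _ f => (RegLevel.step B k).comp f) h

theorem RegLevel.trans_self (B : Type*) [Group B] (m : ℕ) :
    RegLevel.trans B m m le_rfl = MonoidHom.id _ :=
  Nat.leRec_self _ _

theorem RegLevel.trans_succ (B : Type*) [Group B] (m n : ℕ) (h : m ≤ n) :
    RegLevel.trans B m (n + 1) (Nat.le_succ_of_le h) =
      (RegLevel.step B n).comp (RegLevel.trans B m n h) :=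
  Nat.leRec_succ _ _ h

instance RegLevel.directedSystem (B : Type*) [Group B] :
    DirectedSystem (RegLevel B) (RegLevel.trans B · · ·) where
  map_self i x := by
    rw [RegLevel.trans_self]
    rfl
  map_map k j i hij hjk x := by
    induction k, hjk using Nat.le_induction with
    | base => rw [RegLevel.trans_self]; rfl
    | succ k hjk ih =>
      have h1 := RegLevel.trans_succ B j k hjk
      have h2 := RegLevel.trans_succ B i k (hij.trans hjk)
      rw [h1, h2, MonoidHom.comp_apply, MonoidHom.comp_apply, ih]

/-- The limit of regular representations of length `ω` with base `B`: the direct limit `G_ω` of the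
groups `G_n`, a group through the operations of its levels. -/
abbrev RegLimit (B : Type*) [Group B] : Type _ :=
  DirectLimit (RegLevel B) (RegLevel.trans B)

/-- The canonical homomorphism from the level `G_n` to the limit `G_ω`. -/
noncomputable def RegLimit.of (B : Type*) [Group B] (n : ℕ) : RegLevel B n →* RegLimit B where
  toFun x := (Quotient.mk _ ⟨n, x⟩ : DirectLimit (RegLevel B) (RegLevel.trans B))
  map_one' := (DirectLimit.one_def n).symm
  map_mul' x y := (DirectLimit.mul_def n x y).symm

/-- The level `G_n` as a subgroup of `G_ω`. -/
noncomputable def RegLimit.level (B : Type*) [Group B] (n : ℕ) : Subgroup (RegLimit B) :=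
  (RegLimit.of B n).range

/-- For a group `G` with a family of subgroups `G_i`, `i ∈ ι`, and a set `C` of indices, the group
`Aut_C(G)` of `C`-level preserving automorphisms: the automorphisms `φ` of `G` with
`φ[G_i] = G_i` for all `i ∈ C`. -/
def levelPreservingAut {G ι : Type*} [Group G] (L : ι → Subgroup G) (C : Set ι) :
    Subgroup (MulAut G) where
  carrier := {φ | ∀ i ∈ C, φ '' (L i : Set G) = (L i : Set G)}
  one_mem' := fun i _ => Set.image_id _
  mul_mem' := by
    intro φ ψ hφ hψ i hi
    rw [MulAut.coe_mul, Set.image_comp, hψ i hi, hφ i hi]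
  inv_mem' := by
    intro φ hφ i hi
    ext x
    constructor
    · rintro ⟨y, hy, rfl⟩
      rw [← hφ i hi] at hy
      obtain ⟨z, hz, rfl⟩ := hy
      rw [MulAut.inv_apply_self G]
      exact hz
    · intro hx
      refine ⟨φ x, ?_, MulAut.inv_apply_self G φ x⟩
      rw [← hφ i hi]
      exact ⟨x, hx, rfl⟩

/-- Hall's universal locally finite group `G_ω`, as the limit of regular representations of
length `ω` with base `Sym(7)`. -/
abbrev HallGroup : Type := RegLimit (Equiv.Perm (Fin 7))

/-- The numbers `n_0 = 7`, `n_{i+1} = n_i!`. -/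
def hallDegree : ℕ → ℕ
  | 0 => 7
  | i + 1 => (hallDegree i).factorial

/-! Each level is a finite symmetric group of degree at least 7, so it has trivial centre and only
inner automorphisms (`conj_injective`, `conj_surjective`). A level preserving `φ` thus acts on `G_n`
as conjugation by a unique `f n`. Agreement on `G_n` says that `(step (f n))⁻¹ * f (n + 1)`
centralizes the right translations, hence is a left translation by a unique `h n ∈ G_n`
(`exists_leftRegular_eq`). So `φ` amounts to `f 0` and a free choice of all `h n`. Left and right
translations commute, which makes this correspondence multiplicative. -/

namespace Equiv.Perm

/-! ### Transpositions and automorphisms of finite symmetric groups -/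

theorem conj_apply_apply {α : Type*} (g t : Perm α) {x y x' y' : α} (hx : g x = x') (hy : g y = y')
    (h : t x = y) : (g * t * g⁻¹) x' = y' := by
  subst hx hy h; simp

variable {α : Type*} [DecidableEq α]

theorem commute_swap_swap {a b c d : α} (hac : a ≠ c) (had : a ≠ d) (hbc : b ≠ c) (hbd : b ≠ d) :
    Commute (swap a b) (swap c d) := by
  ext x
  simp only [mul_apply, swap_apply_def]
  grind

theorem swap_mul_swap_same_pow_six (a b d : α) : (swap a b * swap a d) ^ 6 = 1 := by
  have sq : ∀ x y : α, swap x y ^ 6 = 1 := fun x y => by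
    rw [show 6 = 2 * 3 from rfl, pow_mul, pow_two, swap_mul_self, one_pow]
  rcases eq_or_ne a b with rfl | hab
  · rw [swap_self, ← one_def, one_mul, sq]
  rcases eq_or_ne a d with rfl | had
  · rw [swap_self, ← one_def, mul_one, sq]
  rcases eq_or_ne b d with rfl | hbd
  · rw [swap_mul_self, one_pow]
  have h3 : (swap a b * swap a d) ^ 3 = 1 := by
    have h2 := swap_mul_swap_mul_swap hab.symm hbd
    rw [swap_comm b a] at h2
    rw [pow_succ, pow_two, ← mul_assoc]
    have h2' : swap a d * swap a b * swap a d = swap b d := by rw [h2, swap_comm]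
    calc swap a b * swap a d * swap a b * swap a d * (swap a b * swap a d)
        = swap a b * (swap a d * swap a b * swap a d) * (swap a b * swap a d) := by
          simp only [mul_assoc]
      _ = (swap a b * swap d b * swap a b) * swap a d := by
          rw [h2', swap_comm d b]; simp only [mul_assoc]
      _ = 1 := by
          rw [swap_comm a b, swap_comm d b, swap_comm b d,
            swap_mul_swap_mul_swap hbd.symm had.symm, swap_mul_self]
  rw [show 6 = 3 * 2 from rfl, pow_mul, h3, one_pow]

/-- The product is trivial, a 3-cycle or a double transposition. With its converse below, this
describes transpositions in terms invariant under automorphisms. -/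
theorem IsSwap.mul_pow_six {s r : Perm α} (hs : s.IsSwap) (hr : r.IsSwap) : (s * r) ^ 6 = 1 := by
  obtain ⟨a, b, hab, rfl⟩ := hs
  obtain ⟨c, d, hcd, rfl⟩ := hr
  by_cases hac : a = c
  · subst hac; exact swap_mul_swap_same_pow_six a b d
  by_cases had : a = d
  · subst had; rw [swap_comm c a]; exact swap_mul_swap_same_pow_six a b c
  by_cases hbc : b = c
  · subst hbc; rw [swap_comm a b]; exact swap_mul_swap_same_pow_six b a d
  by_cases hbd : b = d
  · subst hbd; rw [swap_comm a b, swap_comm c b]; exact swap_mul_swap_same_pow_six b a c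
  rw [(commute_swap_swap hac had hbc hbd).mul_pow, show 6 = 2 * 3 from rfl, pow_mul, pow_mul]
  simp [pow_two]

theorem IsSwap.exists_common_point {s r : Perm α} (hs : s.IsSwap) (hr : r.IsSwap)
    (h : ¬ Commute s r) :
    ∃ b p q, b ≠ p ∧ b ≠ q ∧ p ≠ q ∧ s = swap b p ∧ r = swap b q := by
  have aux : ∀ {b p q : α}, b ≠ p → b ≠ q → s = swap b p → r = swap b q →
      ∃ b p q, b ≠ p ∧ b ≠ q ∧ p ≠ q ∧ s = swap b p ∧ r = swap b q := by
    intro b p q hbp hbq h1 h2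
    refine ⟨b, p, q, hbp, hbq, ?_, h1, h2⟩
    rintro rfl
    exact h (by rw [h1, h2])
  obtain ⟨a, b, hab, h1⟩ := hs
  obtain ⟨c, d, hcd, h2⟩ := hr
  by_cases hac : a = c
  · subst hac; exact aux hab hcd h1 h2
  by_cases had : a = d
  · subst had; exact aux hab hcd.symm h1 (by rw [h2, swap_comm])
  by_cases hbc : b = c
  · subst hbc; exact aux hab.symm hcd (by rw [h1, swap_comm]) h2
  by_cases hbd : b = d
  · subst hbd; exact aux hab.symm hcd.symm (by rw [h1, swap_comm]) (by rw [h2, swap_comm])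
  exact (h (by rw [h1, h2]; exact commute_swap_swap hac had hbc hbd)).elim

theorem not_commute_swap_swap {a x y : α} (hax : a ≠ x) (hay : a ≠ y) (hxy : x ≠ y) :
    ¬ Commute (swap a x) (swap a y) := by
  intro h
  have := congrArg (fun f => f a) h.eq
  simp only [mul_apply, swap_apply_def] at this
  grind

theorem eq_of_commute_of_apply_ne {s r : Perm α} (hs : s.IsSwap) (hr : r.IsSwap)
    (h : Commute s r) {b : α} (hsb : s b ≠ b) (hrb : r b ≠ b) : s = r := by
  have key : ∀ {t : Perm α}, t.IsSwap → t b ≠ b → t = swap b (t b) := by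
    rintro _ ⟨a, c, -, rfl⟩ h
    rcases eq_or_ne b a with rfl | h1
    · simp
    rcases eq_or_ne b c with rfl | h2
    · simp [swap_comm]
    exact (h (swap_apply_of_ne_of_ne h1 h2)).elim
  by_contra hne
  have h1 := key hs hsb
  have h2 := key hr hrb
  refine not_commute_swap_swap hsb.symm hrb.symm (fun e => hne ?_) (h1 ▸ h2 ▸ h)
  rw [h1, h2, e]

theorem IsSwap.eq_swap_of_apply_ne {s : Perm α} (hs : s.IsSwap) {b c : α} (hbc : b ≠ c)
    (hb : s b ≠ b) (hc : s c ≠ c) : s = swap b c := by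
  obtain ⟨u, v, -, rfl⟩ := hs
  have hb' : b = u ∨ b = v := by
    by_contra! h; exact hb (swap_apply_of_ne_of_ne h.1 h.2)
  have hc' : c = u ∨ c = v := by
    by_contra! h; exact hc (swap_apply_of_ne_of_ne h.1 h.2)
  rcases hb' with rfl | rfl <;> rcases hc' with rfl | rfl <;> simp_all [swap_comm]

/-- In a symmetric group on at least seven points, an involution whose products with its conjugates
all have order dividing six is a transposition. -/
theorem isSwap_of_forall_conj_pow_six [Fintype α] (hα : 7 ≤ Fintype.card α) {t : Perm α}
    (h1 : t ≠ 1) (h2 : t * t = 1) (h6 : ∀ g : Perm α, (t * (g * t * g⁻¹)) ^ 6 = 1) :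
    t.IsSwap := by
  have tt : ∀ x, t (t x) = x := fun x => by rw [← mul_apply, h2, one_apply]
  have inj : ∀ {x y}, t x = t y → x = y := fun h => t.injective h
  obtain ⟨a, ha⟩ : ∃ a, t a ≠ a := by
    by_contra! h; exact h1 (ext h)
  by_contra hns
  obtain ⟨c, hc⟩ : ∃ c, t c ≠ swap a (t a) c := by
    by_contra! h; exact hns ⟨a, t a, ha.symm, ext h⟩
  have hca : c ≠ a := by rintro rfl; simp at hc
  have hcb : c ≠ t a := by rintro rfl; simp [tt] at hc
  rw [swap_apply_of_ne_of_ne hca hcb] at hc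
  obtain ⟨b, hb⟩ : ∃ b, b = t a := ⟨_, rfl⟩
  obtain ⟨d, hd⟩ : ∃ d, d = t c := ⟨_, rfl⟩
  have hb' : t b = a := by rw [hb, tt]
  have hd' : t d = c := by rw [hd, tt]
  have hda : d ≠ a := by rintro rfl; exact hcb (by rw [hd, tt])
  have hdb : d ≠ b := by rintro rfl; exact hca (inj (hd.symm.trans hb))
  rw [← hb] at ha hcb
  rw [← hd] at hc
  by_cases hfix : ∃ e, t e = e
  · obtain ⟨e, he⟩ := hfix
    have hea : e ≠ a := by rintro rfl; exact ha (by rw [hb, he])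
    have heb : e ≠ b := by rintro rfl; exact ha (by rw [← hb', he])
    have hec : e ≠ c := by rintro rfl; exact hc (by rw [hd, he])
    have hed : e ≠ d := by rintro rfl; exact hc (by rw [← hd', he])
    -- The 5-cycle `a → b → c → d → e → a`. The conjugate of `t` acts here as `(b c)(d e)`, so its
    -- product with `t` is a 5-cycle on these points.
    let g : Perm α := swap a b * swap b c * swap c d * swap d e
    have ga : g a = b := by simp only [g, mul_apply, swap_apply_def]; grind
    have gb : g b = c := by simp only [g, mul_apply, swap_apply_def]; grind
    have gc : g c = d := by simp only [g, mul_apply, swap_apply_def]; grind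
    have gd : g d = e := by simp only [g, mul_apply, swap_apply_def]; grind
    have ge : g e = a := by simp only [g, mul_apply, swap_apply_def]; grind
    have ra := conj_apply_apply g t ge ge he
    have rb := conj_apply_apply g t ga gb hb.symm
    have rc := conj_apply_apply g t gb ga hb'
    have rd := conj_apply_apply g t gc gd hd.symm
    have re := conj_apply_apply g t gd gc hd'
    have := congrArg (fun f => f a) (h6 g)
    generalize g * t * g⁻¹ = t' at *
    simp only [pow_succ, pow_zero, one_mul, mul_apply, one_apply, ra, rb, rc, rd, re, ← hb, hb',
      ← hd, hd', he] at this
    exact ha this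
  · push Not at hfix
    -- Without fixed points, seven points force four 2-cycles. In degree 6 the products of three
    -- disjoint transpositions would be counterexamples.
    have hex : ∀ s : Finset α, s.card ≤ 6 → ∃ x, x ∉ s := fun s hs => by
      by_contra! h
      have := Finset.card_le_card (fun x _ => h x : Finset.univ ⊆ s)
      rw [Finset.card_univ] at this
      omega
    obtain ⟨e, he⟩ := hex {a, b, c, d} (Finset.card_le_four.trans (by norm_num))
    obtain ⟨f, hf⟩ : ∃ f, f = t e := ⟨_, rfl⟩
    have hf' : t f = e := by rw [hf, tt]
    obtain ⟨i, hi⟩ := hex {a, b, c, d, e, f} Finset.card_le_six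
    obtain ⟨j, hj⟩ : ∃ j, j = t i := ⟨_, rfl⟩
    have hj' : t j = i := by rw [hj, tt]
    simp only [Finset.mem_insert, Finset.mem_singleton, not_or] at he hi
    have hef := hfix e
    have hij := hfix i
    rw [← hf] at hef
    rw [← hj] at hij
    have hfa : f ≠ a := by grind
    have hfb : f ≠ b := by grind
    have hfc : f ≠ c := by grind
    have hfd : f ≠ d := by grind
    have hja : j ≠ a := by grind
    have hjb : j ≠ b := by grind
    have hjc : j ≠ c := by grind
    have hjd : j ≠ d := by grind
    have hje : j ≠ e := by grind
    have hjf : j ≠ f := by grind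
    -- An 8-cycle. The product of `t` and its conjugate runs `a → i → e → c → a`, so its sixth power
    -- sends `a` to `e`.
    let g : Perm α := swap a b * swap b c * swap c d * swap d e * swap e f * swap f i * swap i j
    have ga : g a = b := by simp only [g, mul_apply, swap_apply_def]; grind
    have gb : g b = c := by simp only [g, mul_apply, swap_apply_def]; grind
    have gc : g c = d := by simp only [g, mul_apply, swap_apply_def]; grind
    have gd : g d = e := by simp only [g, mul_apply, swap_apply_def]; grind
    have ge : g e = f := by simp only [g, mul_apply, swap_apply_def]; grind
    have gf : g f = i := by simp only [g, mul_apply, swap_apply_def]; grind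
    have gi : g i = j := by simp only [g, mul_apply, swap_apply_def]; grind
    have gj : g j = a := by simp only [g, mul_apply, swap_apply_def]; grind
    have ra := conj_apply_apply g t gj gi hj'
    have ri := conj_apply_apply g t gf ge hf'
    have re := conj_apply_apply g t gd gc hd'
    have rc := conj_apply_apply g t gb ga hb'
    have := congrArg (fun f => f a) (h6 g)
    generalize g * t * g⁻¹ = t' at *
    simp only [pow_succ, pow_zero, one_mul, mul_apply, one_apply, ra, rc, re, ri, hb', hd', hf', hj'] at this
    exact he.1 this

variable [Fintype α]

theorem IsSwap.map_mulAut (hα : 7 ≤ Fintype.card α) (φ : MulAut (Perm α)) {s : Perm α}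
    (hs : s.IsSwap) : (φ s).IsSwap := by
  refine isSwap_of_forall_conj_pow_six hα ?_ ?_ fun g => ?_
  · obtain ⟨a, b, hab, rfl⟩ := hs
    rw [ne_eq, map_eq_one_iff φ φ.injective, swap_eq_one_iff]
    exact hab
  · obtain ⟨a, b, hab, rfl⟩ := hs
    rw [← map_mul, swap_mul_self, map_one]
  · obtain ⟨g, rfl⟩ := φ.surjective g
    rw [← map_inv, ← map_mul, ← map_mul, ← map_mul, ← map_pow, hs.mul_pow_six, map_one]
    obtain ⟨a, b, hab, rfl⟩ := hs
    exact ⟨g a, g b, g.injective.ne hab, by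
      rw [swap_apply_apply]⟩

/-- The images of the `swap a x` are pairwise noncommuting transpositions, so any two share a point
and they form a star or a triangle. The centre `b` of the star will be the image of `a` under the
conjugating permutation. -/
theorem exists_forall_swap_apply_ne (hα : 7 ≤ Fintype.card α) (φ : MulAut (Perm α)) (a : α) :
    ∃ b, ∀ x, a ≠ x → φ (swap a x) b ≠ b := by
  have hsw : ∀ {x y : α}, x ≠ y → (φ (swap x y)).IsSwap := fun h =>
    IsSwap.map_mulAut hα φ ⟨_, _, h, rfl⟩
  have hnc : ∀ {x y : α}, a ≠ x → a ≠ y → x ≠ y → ¬ Commute (φ (swap a x)) (φ (swap a y)) :=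
    fun h1 h2 h3 h => not_commute_swap_swap h1 h2 h3 (φ.injective (by
      rw [map_mul, map_mul]; exact h.eq))
  obtain ⟨x, hx⟩ : ∃ x, x ∉ ({a} : Finset α) := by
    by_contra! h
    have := Finset.card_le_card (fun x _ => h x : Finset.univ ⊆ {a})
    rw [Finset.card_univ, Finset.card_singleton] at this
    omega
  obtain ⟨y, hy⟩ : ∃ y, y ∉ ({a, x} : Finset α) := by
    by_contra! h
    have := (Finset.card_le_card (fun x _ => h x : Finset.univ ⊆ {a, x})).trans Finset.card_le_two
    rw [Finset.card_univ] at this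
    omega
  simp only [Finset.mem_insert, Finset.mem_singleton, not_or] at hx hy
  have hax : a ≠ x := Ne.symm hx
  have hay : a ≠ y := Ne.symm hy.1
  have hxy : x ≠ y := Ne.symm hy.2
  obtain ⟨b, p, q, hbp, hbq, hpq, ep, eq⟩ :=
    (hsw hax).exists_common_point (hsw hay) (hnc hax hay hxy)
  have epq : φ (swap x y) = swap p q := by
    rw [← swap_mul_swap_mul_swap hay.symm hxy.symm, swap_comm y a, map_mul, map_mul, ep, eq,
      swap_comm b q, swap_mul_swap_mul_swap hbq.symm hpq.symm]
  refine ⟨b, fun z haz => ?_⟩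
  rcases eq_or_ne z x with rfl | hzx
  · rw [ep]; simpa using hbp.symm
  rcases eq_or_ne z y with rfl | hzy
  · rw [eq]; simpa using hbq.symm
  have n1 := hnc haz hax hzx
  have n2 := hnc haz hay hzy
  -- Excludes the triangle: its third side is already the image of `swap x y`.
  have n3 : φ (swap a z) ≠ swap p q := by
    rw [← epq]
    intro h
    have := congrArg (fun f => f a) (φ.injective h)
    simp only [swap_apply_left, swap_apply_of_ne_of_ne hax hay] at this
    exact haz this.symm
  intro hb
  obtain ⟨u, v, huv, e⟩ := hsw haz
  rw [e] at n1 n2 n3 hb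
  rw [ep] at n1
  rw [eq] at n2
  have hbu : u ≠ b := by rintro rfl; simp [huv.symm] at hb
  have hbv : v ≠ b := by rintro rfl; simp [huv] at hb
  have hp : u = p ∨ v = p := by
    by_contra! h; exact n1 (commute_swap_swap hbu h.1 hbv h.2)
  have hq : u = q ∨ v = q := by
    by_contra! h; exact n2 (commute_swap_swap hbu h.1 hbv h.2)
  rcases hp with rfl | rfl <;> rcases hq with rfl | rfl <;> simp_all [swap_comm]

theorem conj_surjective (hα : 7 ≤ Fintype.card α) :
    Function.Surjective (MulAut.conj : Perm α →* MulAut (Perm α)) := by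
  intro φ
  choose σ hσ using exists_forall_swap_apply_ne hα φ
  have hsw : ∀ {x y : α}, x ≠ y → (φ (swap x y)).IsSwap := fun h =>
    IsSwap.map_mulAut hα φ ⟨_, _, h, rfl⟩
  have inj : Function.Injective σ := by
    intro a c hac
    by_contra hne
    obtain ⟨x, hx⟩ : ∃ x, x ∉ ({a, c} : Finset α) := by
      by_contra! h
      have := (Finset.card_le_card (fun x _ => h x : Finset.univ ⊆ {a, c})).trans Finset.card_le_two
      rw [Finset.card_univ] at this
      omega
    obtain ⟨y, hy⟩ : ∃ y, y ∉ ({a, c, x} : Finset α) := by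
      by_contra! h
      have := (Finset.card_le_card (fun x _ => h x : Finset.univ ⊆ {a, c, x})).trans
        Finset.card_le_three
      rw [Finset.card_univ] at this
      omega
    simp only [Finset.mem_insert, Finset.mem_singleton, not_or] at hx hy
    -- Disjoint transpositions whose images would both move `σ a = σ c`; being commuting
    -- transpositions, the images would coincide.
    have hcom : Commute (swap a x) (swap c y) :=
      commute_swap_swap hne (Ne.symm hy.1) hx.2 (Ne.symm hy.2.2)
    have h := φ.injective (eq_of_commute_of_apply_ne (hsw (Ne.symm hx.1)) (hsw (Ne.symm hy.2.1))
      (hcom.map φ) (hσ a x (Ne.symm hx.1)) (hac ▸ hσ c y (Ne.symm hy.2.1)))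
    have := congrArg (fun f => f a) h
    simp only [swap_apply_left, swap_apply_of_ne_of_ne hne (Ne.symm hy.1)] at this
    exact hx.1 this
  let τ : Perm α := Equiv.ofBijective σ (Finite.injective_iff_bijective.mp inj)
  refine ⟨τ, ?_⟩
  have : (MulAut.conj τ).toMonoidHom = φ.toMonoidHom := by
    refine MonoidHom.eq_of_eqOn_dense closure_isSwap ?_
    rintro _ ⟨x, y, hxy, rfl⟩
    change τ * swap x y * τ⁻¹ = φ (swap x y)
    rw [← swap_apply_apply]
    refine ((hsw hxy).eq_swap_of_apply_ne (inj.ne hxy) (hσ x y hxy) ?_).symm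
    rw [swap_comm]
    exact hσ y x hxy.symm
  ext1 x
  exact DFunLike.congr_fun this x

theorem conj_injective (hα : 3 ≤ Fintype.card α) :
    Function.Injective (MulAut.conj : Perm α →* MulAut (Perm α)) := by
  rw [injective_iff_map_eq_one]
  intro g hg
  have hc : ∀ s, g * s * g⁻¹ = s := fun s => by
    rw [← MulAut.conj_apply, hg, MulAut.one_apply]
  ext x
  by_contra hx
  rw [one_apply] at hx
  obtain ⟨y, hy⟩ : ∃ y, y ∉ ({x, g x} : Finset α) := by
    by_contra! h
    have := (Finset.card_le_card (fun x _ => h x : Finset.univ ⊆ {x, g x})).trans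
      Finset.card_le_two
    rw [Finset.card_univ] at this
    omega
  simp only [Finset.mem_insert, Finset.mem_singleton, not_or] at hy
  have := congrArg (fun f => f x) (hc (swap x y))
  simp only [← swap_apply_apply, swap_apply_left] at this
  rw [swap_apply_of_ne_of_ne (Ne.symm hx)] at this
  · exact hy.1 this.symm
  · intro h
    rw [← h] at this
    grind

end Equiv.Perm

/-! ### Left translations as the centralizer of right translations -/

/-- The left regular representation of a group `G` in the group of permutations of `G`. -/
def leftRegular (G : Type*) [Group G] : G →* Equiv.Perm G where
  toFun g := Equiv.mulLeft g
  map_one' := by ext x; simp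
  map_mul' g h := by ext x; simp

theorem commute_rightRegular_leftRegular {G : Type*} [Group G] (g h : G) :
    Commute (rightRegular G g) (leftRegular G h) := by
  ext x
  simp [rightRegular, leftRegular, mul_assoc]

theorem rightRegular_injective (G : Type*) [Group G] : Function.Injective (rightRegular G) := by
  intro g h e
  have := congrArg (fun f : Equiv.Perm G => f 1) e
  simpa [rightRegular] using this

theorem leftRegular_injective (G : Type*) [Group G] : Function.Injective (leftRegular G) := by
  intro g h e
  have := congrArg (fun f : Equiv.Perm G => f 1) e
  simpa [leftRegular] using this

theorem exists_leftRegular_eq {G : Type*} [Group G] {c : Equiv.Perm G}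
    (hc : ∀ g, Commute (rightRegular G g) c) : ∃ h, leftRegular G h = c := by
  refine ⟨c 1, ?_⟩
  ext x
  -- `rightRegular G x⁻¹` is `y ↦ y * x`, so evaluation at `1` gives `c x = c 1 * x`.
  have := congrArg (fun f : Equiv.Perm G => f 1) (hc x⁻¹).eq
  simpa [rightRegular, leftRegular] using this

/-! ### Compatible sequences of conjugators -/

namespace RegLevel

variable (B : Type*) [Group B]

/-- The left regular representation of a level in the next one. -/
def left (n : ℕ) : RegLevel B n →* RegLevel B (n + 1) :=
  leftRegular (RegLevel B n)

variable {B}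

theorem commute_step_left {n : ℕ} (g h : RegLevel B n) : Commute (step B n g) (left B n h) :=
  commute_rightRegular_leftRegular g h

theorem step_injective (n : ℕ) : Function.Injective (step B n) :=
  rightRegular_injective (RegLevel B n)

theorem left_injective (n : ℕ) : Function.Injective (left B n) :=
  leftRegular_injective (RegLevel B n)

theorem exists_left_eq {n : ℕ} {c : RegLevel B (n + 1)} (hc : ∀ g, Commute (step B n g) c) :
    ∃ h, left B n h = c :=
  exists_leftRegular_eq (G := RegLevel B n) hc

theorem trans_injective (m n : ℕ) (h : m ≤ n) : Function.Injective (trans B m n h) := by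
  induction n, h using Nat.le_induction with
  | base => rw [trans_self]; exact fun _ _ e => e
  | succ n h ih => rw [trans_succ B m n h]; exact (step_injective n).comp ih

variable (B) in
/-- The sequence of conjugators attached to `b ∈ G_0` and `h ∈ ∏ G_n`: it starts with `b`, and the
conjugator in `G_{n+1}` is the product of the right translation by the conjugator in `G_n` and the
left translation by `h n`. -/
def conjugator : (n : ℕ) → B × ((i : ℕ) → RegLevel B i) →* RegLevel B n
  | 0 => MonoidHom.fst _ _
  | n + 1 =>
    { toFun p := step B n (conjugator n p) * left B n (p.2 n)
      map_one' := by simp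
      map_mul' p q := by
        simp only [map_mul, Prod.snd_mul, Pi.mul_apply]
        rw [(commute_step_left _ _).mul_mul_mul_comm] }

theorem conjugator_succ (n : ℕ) (p : B × ((i : ℕ) → RegLevel B i)) :
    conjugator B (n + 1) p = step B n (conjugator B n p) * left B n (p.2 n) := rfl

theorem conjugator_eq_one {p : B × ((i : ℕ) → RegLevel B i)} (h : ∀ n, conjugator B n p = 1) :
    p = 1 := by
  refine Prod.ext (h 0) (funext fun n => left_injective n ?_)
  have := h (n + 1)
  rw [conjugator_succ, h n, map_one, one_mul] at this
  rw [this]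
  exact (map_one (left B n)).symm

/-- The left translation in the new conjugator centralizes `G_n`, so it cancels. -/
theorem conj_step_conjugator (n : ℕ) (p : B × ((i : ℕ) → RegLevel B i)) (x : RegLevel B n) :
    MulAut.conj (conjugator B (n + 1) p) (step B n x) =
      step B n (MulAut.conj (conjugator B n p) x) := by
  rw [conjugator_succ, MulAut.conj_apply, MulAut.conj_apply, map_mul, map_mul, map_inv,
    mul_inv_rev]
  have := (commute_step_left x (p.2 n)).eq
  simp only [mul_assoc]
  rw [← mul_assoc (left B n _) (step B n x), ← this]
  simp [mul_assoc]

theorem conj_trans_conjugator (m n : ℕ) (h : m ≤ n) (p : B × ((i : ℕ) → RegLevel B i))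
    (x : RegLevel B m) :
    trans B m n h (MulAut.conj (conjugator B m p) x) =
      MulAut.conj (conjugator B n p) (trans B m n h x) := by
  induction n, h using Nat.le_induction with
  | base => rw [trans_self]; rfl
  | succ n h ih =>
    rw [trans_succ B m n h, MonoidHom.comp_apply, MonoidHom.comp_apply, ih,
      conj_step_conjugator]

theorem exists_conjugator_eq (f : (n : ℕ) → RegLevel B n)
    (hf : ∀ n x, MulAut.conj (f (n + 1)) (step B n x) = step B n (MulAut.conj (f n) x)) :
    ∃ p, ∀ n, conjugator B n p = f n := by
  have hc : ∀ n, ∃ h, left B n h = (step B n (f n))⁻¹ * f (n + 1) := fun n => by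
    refine exists_left_eq fun x => ?_
    have := hf n x
    simp only [MulAut.conj_apply, map_mul, map_inv] at this
    rw [mul_inv_eq_iff_eq_mul] at this
    change _ * _ = _ * _
    rw [mul_assoc, this]
    simp [mul_assoc]
  choose h hh using hc
  refine ⟨(f 0, h), fun n => ?_⟩
  induction n with
  | zero => rfl
  | succ n ih => rw [conjugator_succ, ih, hh, mul_inv_cancel_left]

end RegLevel

/-! ### Level preserving automorphisms of the limit -/

namespace RegLimit

variable {B : Type*} [Group B]

open RegLevel

theorem of_injective (n : ℕ) : Function.Injective (of B n) :=
  DirectLimit.mk_injective _ (trans_injective (B := B)) n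

theorem of_trans (m n : ℕ) (h : m ≤ n) (x : RegLevel B m) : of B n (trans B m n h x) = of B m x :=
  DirectLimit.mk_apply m n x h

theorem of_step (n : ℕ) (x : RegLevel B n) : of B (n + 1) (step B n x) = of B n x := by
  rw [← of_trans n (n + 1) n.le_succ, trans_succ B n n le_rfl, trans_self]
  rfl

theorem exists_of_eq (z : RegLimit B) : ∃ n x, of B n x = z := by
  obtain ⟨n, x, rfl⟩ := DirectLimit.exists_eq_mk _ z
  exact ⟨n, x, rfl⟩

/-- Sequences of conjugators act on the limit: on the level `G_n` by conjugation with the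
conjugator in `G_n`. -/
noncomputable instance : MulDistribMulAction (B × ((i : ℕ) → RegLevel B i)) (RegLimit B) where
  smul p := DirectLimit.map _ _ (fun n => MulAut.conj (conjugator B n p))
    fun m n h x => conj_trans_conjugator m n h p x
  one_smul z := by
    obtain ⟨n, x, rfl⟩ := exists_of_eq z
    change of B n (MulAut.conj (conjugator B n 1) x) = _
    simp
  mul_smul p q z := by
    obtain ⟨n, x, rfl⟩ := exists_of_eq z
    change of B n (MulAut.conj (conjugator B n (p * q)) x) =
      of B n (MulAut.conj (conjugator B n p) (MulAut.conj (conjugator B n q) x))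
    rw [map_mul, map_mul, MulAut.mul_apply]
  smul_one p := by
    change DirectLimit.map _ _ _ _ 1 = 1
    rw [← map_one (of B 0)]
    change of B 0 (MulAut.conj (conjugator B 0 p) 1) = _
    rw [map_one]
  smul_mul p z w := by
    obtain ⟨n, x, y, rfl, rfl⟩ := DirectLimit.exists_eq_mk₂ _ z w
    change DirectLimit.map _ _ _ _ (of B n x * of B n y) = of B n (MulAut.conj (conjugator B n p) x) *
      of B n (MulAut.conj (conjugator B n p) y)
    rw [← map_mul, ← map_mul, ← map_mul]
    rfl

theorem smul_of (p : B × ((i : ℕ) → RegLevel B i)) (n : ℕ) (x : RegLevel B n) :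
    p • of B n x = of B n (MulAut.conj (conjugator B n p) x) := rfl

theorem smul_mem_level (p : B × ((i : ℕ) → RegLevel B i)) (n : ℕ) {z : RegLimit B}
    (hz : z ∈ level B n) : p • z ∈ level B n := by
  obtain ⟨x, rfl⟩ := hz
  exact ⟨_, (smul_of p n x).symm⟩

/-- The action of the sequences of conjugators by level preserving automorphisms. -/
noncomputable def toLevelPreservingAut (B : Type*) [Group B] :
    B × ((i : ℕ) → RegLevel B i) →* levelPreservingAut (level B) (Set.univ : Set ℕ) :=
  (MulDistribMulAction.toMulAut (B × ((i : ℕ) → RegLevel B i)) (RegLimit B)).codRestrict _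
    fun p n _ => by
      ext z
      constructor
      · rintro ⟨w, hw, rfl⟩
        exact smul_mem_level p n hw
      · exact fun hz => ⟨p⁻¹ • z, smul_mem_level p⁻¹ n hz, smul_inv_smul p z⟩

theorem toLevelPreservingAut_apply_of (p : B × ((i : ℕ) → RegLevel B i)) (n : ℕ)
    (x : RegLevel B n) : (toLevelPreservingAut B p : MulAut (RegLimit B)) (of B n x) =
      of B n (MulAut.conj (conjugator B n p) x) := rfl

theorem toLevelPreservingAut_injective
    (h : ∀ n, Function.Injective (MulAut.conj : RegLevel B n →* MulAut (RegLevel B n))) :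
    Function.Injective (toLevelPreservingAut B) := by
  rw [injective_iff_map_eq_one]
  refine fun p hp => conjugator_eq_one fun n => h n ?_
  ext x
  refine of_injective n ?_
  rw [← toLevelPreservingAut_apply_of, hp, map_one]
  rfl

theorem exists_conj_of_mem_levelPreservingAut
    (h : ∀ n, Function.Surjective (MulAut.conj : RegLevel B n →* MulAut (RegLevel B n)))
    {φ : MulAut (RegLimit B)} (hφ : φ ∈ levelPreservingAut (level B) (Set.univ : Set ℕ)) (n : ℕ) :
    ∃ f : RegLevel B n, ∀ x, φ (of B n x) = of B n (MulAut.conj f x) := by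
  have h1 : ∀ x, ∃ y, of B n y = φ (of B n x) := fun x => by
    have : φ (of B n x) ∈ φ '' (level B n : Set (RegLimit B)) := ⟨_, ⟨x, rfl⟩, rfl⟩
    rwa [hφ n (Set.mem_univ n)] at this
  have h2 : ∀ y, ∃ x, of B n y = φ (of B n x) := fun y => by
    have : of B n y ∈ (level B n : Set (RegLimit B)) := ⟨y, rfl⟩
    rw [← hφ n (Set.mem_univ n)] at this
    obtain ⟨_, ⟨x, rfl⟩, e⟩ := this
    exact ⟨x, e.symm⟩
  choose ψ hψ using h1
  let ψ' : RegLevel B n →* RegLevel B n :=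
    { toFun := ψ
      map_one' := of_injective n (by rw [hψ, map_one, map_one])
      map_mul' x y := of_injective n (by rw [hψ, map_mul, map_mul, map_mul, hψ, hψ]) }
  have hb : Function.Bijective ψ' := by
    constructor
    · intro x y e
      have e' : ψ x = ψ y := e
      exact of_injective n (φ.injective (by rw [← hψ, ← hψ, e']))
    · intro y
      obtain ⟨x, hx⟩ := h2 y
      exact ⟨x, of_injective n (by rw [hx]; exact hψ x)⟩
  obtain ⟨f, hf⟩ := h n (MulEquiv.ofBijective ψ' hb)
  refine ⟨f, fun x => ?_⟩
  rw [hf]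
  exact (hψ x).symm

theorem toLevelPreservingAut_surjective
    (h : ∀ n, Function.Surjective (MulAut.conj : RegLevel B n →* MulAut (RegLevel B n))) :
    Function.Surjective (toLevelPreservingAut B) := by
  rintro ⟨φ, hφ⟩
  choose f hf using exists_conj_of_mem_levelPreservingAut h hφ
  -- Both conjugations describe `φ` on the same element of the limit.
  obtain ⟨p, hp⟩ := exists_conjugator_eq f fun n x => of_injective (n + 1) (by
    rw [← hf, of_step, of_step, hf])
  refine ⟨p, Subtype.ext (MulEquiv.ext fun z => ?_)⟩
  obtain ⟨n, x, rfl⟩ := exists_of_eq z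
  rw [toLevelPreservingAut_apply_of, hp, ← hf]

/-- If all automorphisms of the levels are inner, by unique elements, then the group of level
preserving automorphisms of the limit is the product of the base and all levels. -/
noncomputable def levelPreservingAutEquiv
    (h : ∀ n, Function.Bijective (MulAut.conj : RegLevel B n →* MulAut (RegLevel B n))) :
    B × ((i : ℕ) → RegLevel B i) ≃* levelPreservingAut (level B) (Set.univ : Set ℕ) :=
  MulEquiv.ofBijective (toLevelPreservingAut B)
    ⟨toLevelPreservingAut_injective fun n => (h n).1,
      toLevelPreservingAut_surjective fun n => (h n).2⟩

end RegLimit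

/-! ### The levels of Hall's group as symmetric groups -/

theorem MulAut.conj_bijective_of_mulEquiv {G H : Type*} [Group G] [Group H] (e : G ≃* H)
    (h : Function.Bijective (MulAut.conj : H →* MulAut H)) :
    Function.Bijective (MulAut.conj : G →* MulAut G) := by
  have : (MulAut.conj : G → MulAut G) =
      (MulAut.congr e).symm ∘ (MulAut.conj : H → MulAut H) ∘ e := by
    ext g x
    simp [MulAut.congr]
  rw [this]
  exact (MulAut.congr e).symm.bijective.comp (h.comp e.bijective)

theorem seven_le_hallDegree (n : ℕ) : 7 ≤ hallDegree n := by
  induction n with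
  | zero => exact le_rfl
  | succ n ih => exact ih.trans (Nat.self_le_factorial _)

/-- The level `G_n` of Hall's group is the symmetric group of degree `n_n`. -/
theorem RegLevel.nonempty_mulEquiv_perm_fin (n : ℕ) :
    Nonempty (RegLevel (Equiv.Perm (Fin 7)) n ≃* Equiv.Perm (Fin (hallDegree n))) := by
  induction n with
  | zero => exact ⟨MulEquiv.refl (Equiv.Perm (Fin 7))⟩
  | succ n ih =>
    obtain ⟨e⟩ := ih
    have e' : Equiv.Perm (Fin (hallDegree n)) ≃ Fin (hallDegree (n + 1)) :=
      Fintype.equivFinOfCardEq (by rw [Fintype.card_perm, Fintype.card_fin]; rfl)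
    exact ⟨(e.toEquiv.trans e').permCongrHom⟩

theorem RegLevel.conj_bijective (n : ℕ) :
    Function.Bijective (MulAut.conj : RegLevel (Equiv.Perm (Fin 7)) n →*
      MulAut (RegLevel (Equiv.Perm (Fin 7)) n)) := by
  obtain ⟨e⟩ := nonempty_mulEquiv_perm_fin n
  have h := seven_le_hallDegree n
  refine MulAut.conj_bijective_of_mulEquiv e
    ⟨Equiv.Perm.conj_injective ?_, Equiv.Perm.conj_surjective ?_⟩
  all_goals rw [Fintype.card_fin]; omega

theorem corollary3p4 :
    Nonempty
      (levelPreservingAut (G := HallGroup) (RegLimit.level (Equiv.Perm (Fin 7))) (Set.univ : Set ℕ)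
        ≃* Equiv.Perm (Fin 7) × ((i : ℕ) → Equiv.Perm (Fin (hallDegree i)))) :=
  ⟨(RegLimit.levelPreservingAutEquiv RegLevel.conj_bijective).symm.trans
    ((MulEquiv.refl _).prodCongr
      (MulEquiv.piCongrRight fun i => (RegLevel.nonempty_mulEquiv_perm_fin i).some))⟩
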